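/- All systems are finite-dimensional. A (possibly cyclic) quantum network $\mathfrak N$ consists of finitely many completely positive maps (CPMs) and of compositions $O\hookrightarrow I$ (loop compositions), each connecting an output system of a map to an input system of a map; each system takes part in at most one composition, and $\mathfrak N^{\mathrm{sys}}$ is the set of in- and output systems with composed pairs identified. A sub-network is given by a subset of the maps and a subset of the compositions between them; performing these compositions gives its induced map, from the free inputs to the free outputs. Signalling: in a CPM $\mathcal M$, a set $\mathcal S_1$ of inputs signals to a set $\mathcal S_2$ of outputs if $\operatorname{Tr}_{\mathrm{Out}\setminus \mathcal S_2}\circ\mathcal M\neq \operatorname{Tr}_{\mathrm{Out}\setminus \mathcal S_2}\circ\mathcal M\circ\mathcal N$ for some CPTP map $\mathcal N$ acting on $\mathcal S_1$; in a network, $\mathcal S_1$ signals to $\mathcal S_2$ if it does so in the induced map of some sub-network. Fine-graining: let $\mathcal F$ assign to the systems of a network non-empty, pairwise disjoint sets of systems of another network, and write $\mathcal F(\mathcal S)=\bigcup_{S\in\mathcal S}\mathcal F(S)$. A CPM $\mathcal M^f$ with inputs $\mathcal F(\mathrm{In}(\mathcal M))$ and outputs $\mathcal F(\mathrm{Out}(\mathcal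 M))$ is a fine-graining of $\mathcal M$ if $\mathcal M=\mathrm{Dec}\circ\mathcal M^f\circ\mathrm{Enc}$ for a CPTP map $\mathrm{Enc}$ and a linear map $\mathrm{Dec}$ that is CPTP on the image of $\mathcal M^f\circ\mathrm{Enc}$, and if $\mathcal F(\mathcal S_1)$ signals to $\mathcal F(\mathcal S_2)$ in $\mathcal M^f$ whenever $\mathcal S_1$ signals to $\mathcal S_2$ in $\mathcal M$. A network $\mathfrak N^f$ is a fine-graining of $\mathfrak N$ if the induced map of every sub-network of $\mathfrak N$ has as a fine-graining the induced map of some sub-network of $\mathfrak N^f$. Processes: an $N$-party process is a positive semidefinite operator $W$ on the input systems $A_i^I$ and output systems $A_i^O$ of $N$ parties for which the rule $P=\operatorname{Tr}\big((\bigotimes_i M_i)\,W\big)$, with $M_i$ the (transposed) Choi matrices of the local operations, gives $1$ for all local CPTP maps. It is the Choi matrix of its process map $\mathcal W$, from all the $A_i^O$ to all the $A_i^I$. It is a fixed order process if there is a partial order $\preceq$ on the parties such that, for all local instruments and every party $p$, the joint outcome statistics of all parties $q$ with $p\not\preceq q$ are independent of the setting of $p$. A process network $\mathfrak N_{W,N}$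 consists of $\mathcal W$ and one local CPM for each party (possibly with further free in- and outputs), composed through the $A_i^I$ and the $A_i^O$ only. A process network with possibly communicating parties is one made up of a sub-network with induced map $\mathcal W$ and of further maps that are connected to that sub-network through exactly the systems $A_i^I$ and $A_i^O$, and that need not be in tensor product form among the parties. Spacetime: let $\mathcal T$ be a partially ordered set. For regions $\mathcal R_1,\mathcal R_2\subseteq\mathcal T$ write $\mathcal R_1\xrightarrow{R}\mathcal R_2$ if some point of $\mathcal R_1$ strictly precedes some point of $\mathcal R_2$. A spacetime realisation of $\mathfrak N$ in $\mathcal T$ consists of a region $\mathcal E(S)\subseteq\mathcal T$ for each $S\in\mathfrak N^{\mathrm{sys}}$, a fine-graining $\mathfrak N^f$ of $\mathfrak N$ relative to some $\mathcal F$, and a region $\mathcal E^f(S')$ for each system $S'$ of $\mathfrak N^f$, such that for each $S$ the regions $\mathcal E^f(S')$, $S'\in\mathcal F(S)$, partition $\mathcal E(S)$, and such that the directed graph of the regions $\mathcal E^f(S')$ with the edges $\xrightarrow{R}$ is acyclic. It satisfies relativistic causality if, whenever a set $\mathcal S_1$ of systems signals in $\mathfrak N^f$ to a non-empty set $\mathcal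 S_2$ of systems disjoint from $\mathcal S_1$, this graph has a directed path from the region of some system in $\mathcal S_1$ to that of some system in $\mathcal S_2$. A realisation of a process network has input-output correspondence if for each party $i$ there is a bijection $\beta_i:\mathcal F(A_i^I)\to\mathcal F(A_i^O)$ with $\mathcal E^f(S')\xrightarrow{R}\mathcal E^f(\beta_i(S'))$ for all $S'$. Theorem 2. Let $\mathfrak N_{W,N}$ be a process network of an $N$-party process $W$. For every spacetime realisation of $\mathfrak N_{W,N}$ that has input-output correspondence and satisfies relativistic causality, the fine-grained network $\mathfrak N^f$ of the realisation is a process network, with $M\ge N$ possibly communicating parties, of a fixed order process $W^f$. Each party of $W^f$ belongs to one party of $W$; the input (output) systems of the parties of $W^f$ belonging to party $i$ are exactly the systems in $\mathcal F(A_i^I)$ (in $\mathcal F(A_i^O)$); and the process map of $W^f$ is a fine-graining of the process map of $W$. -/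

import Mathlib

open scoped ComplexOrder

noncomputable section

namespace QCausal

/-! ### Finite-dimensional completely positive maps -/

/-- `id_n ⊗ f`, written with blocks. -/
def amplify {α β : Type} (n : ℕ) (f : Matrix α α ℂ →ₗ[ℂ] Matrix β β ℂ)
    (ρ : Matrix (Fin n × α) (Fin n × α) ℂ) : Matrix (Fin n × β) (Fin n × β) ℂ :=
  Matrix.of fun p q => f (Matrix.of fun x y => ρ (p.1, x) (q.1, y)) p.2 q.2

/-- Complete positivity: every amplification preserves positive semidefiniteness. -/
def IsCP {α β : Type} (f : Matrix α α ℂ →ₗ[ℂ] Matrix β β ℂ) : Prop :=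
  ∀ (n : ℕ) (ρ : Matrix (Fin n × α) (Fin n × α) ℂ), ρ.PosSemidef → (amplify n f ρ).PosSemidef

/-- Completely positive and trace preserving. -/
def IsCPTP {α β : Type} [Fintype α] [Fintype β]
    (f : Matrix α α ℂ →ₗ[ℂ] Matrix β β ℂ) : Prop :=
  IsCP f ∧ ∀ ρ, (f ρ).trace = ρ.trace

/-- `g` is completely positive and trace preserving on the image of `f`. When `ρ` ranges over all
matrices, `amplify n f ρ` ranges over all `n × n` block matrices with blocks in that image. -/
def IsCPTPOnImage {α β γ : Type} [Fintype β] [Fintype γ]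
    (g : Matrix β β ℂ →ₗ[ℂ] Matrix γ γ ℂ) (f : Matrix α α ℂ →ₗ[ℂ] Matrix β β ℂ) : Prop :=
  (∀ (n : ℕ) (ρ : Matrix (Fin n × α) (Fin n × α) ℂ),
      (amplify n f ρ).PosSemidef → (amplify n g (amplify n f ρ)).PosSemidef) ∧
    ∀ ρ, (g (f ρ)).trace = (f ρ).trace

/-! ### Joint systems

Systems carry labels in a type `Sys`; the system `s` has Hilbert space `ℂ ^ dim s`. -/

/-- Computational basis labels of the joint Hilbert space of the systems in `X`. -/
abbrev Config {Sys : Type} (dim : Sys → ℕ) (X : Finset Sys) : Type :=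
  ∀ s : {s // s ∈ X}, Fin (dim s.1)

/-- Operators on the joint Hilbert space of the systems in `X`. -/
abbrev Op {Sys : Type} (dim : Sys → ℕ) (X : Finset Sys) : Type :=
  Matrix (Config dim X) (Config dim X) ℂ

/-- Linear maps from operators on the input systems `X` to operators on the output systems `Y`. A
label in both `X` and `Y` stands for one input and one output with equal Hilbert spaces. -/
abbrev SuperOp {Sys : Type} (dim : Sys → ℕ) (X Y : Finset Sys) : Type :=
  Op dim X →ₗ[ℂ] Op dim Y

/-- Restriction of a basis label to a subset of the systems. -/
def restrict {Sys : Type} {dim : Sys → ℕ} {A X : Finset Sys} (h : A ⊆ X) (x : Config dim X) :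
    Config dim A :=
  fun s => x ⟨s.1, h s.2⟩

/-- The basis label of `X` composed of one of `A` and one of `X \ A`. -/
def glue {Sys : Type} [DecidableEq Sys] {dim : Sys → ℕ} {A X : Finset Sys}
    (u : Config dim A) (v : Config dim (X \ A)) : Config dim X :=
  fun s => if h : s.1 ∈ A then u ⟨s.1, h⟩ else v ⟨s.1, Finset.mem_sdiff.mpr ⟨s.2, h⟩⟩

/-- Partial trace over the systems of `Y` outside `B`. -/
def reduce {Sys : Type} [DecidableEq Sys] {dim : Sys → ℕ} {Y : Finset Sys} (B : Finset Sys)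
    (σ : Op dim Y) : Op dim B :=
  Matrix.of fun a b => ∑ c : Config dim (Y \ B), σ (glue a c) (glue b c)

/-- The operation `N` on the systems `A ⊆ X`, tensored with the identity on `X \ A`. -/
def applyOn {Sys : Type} [DecidableEq Sys] {dim : Sys → ℕ} {A X : Finset Sys} (h : A ⊆ X)
    (N : SuperOp dim A A) (ρ : Op dim X) : Op dim X :=
  Matrix.of fun x y =>
    N (Matrix.of fun u v => ρ (glue u (restrict Finset.sdiff_subset x))
        (glue v (restrict Finset.sdiff_subset y)))
      (restrict h x) (restrict h y)

/-- The set `A` of inputs of `M` signals to the set `B` of outputs of `M`. -/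
def Signals {Sys : Type} [DecidableEq Sys] {dim : Sys → ℕ} {X Y : Finset Sys}
    (M : SuperOp dim X Y) (A B : Finset Sys) : Prop :=
  B ⊆ Y ∧ ∃ hA : A ⊆ X, ∃ N : SuperOp dim A A, IsCPTP N ∧
    ∃ ρ : Op dim X, reduce B (M ρ) ≠ reduce B (M (applyOn hA N ρ))

/-- `M'` is a fine-graining of `M` with respect to the assignment `F` of sets of systems. -/
structure IsFineGraining {Sys Sys' : Type} [DecidableEq Sys] [DecidableEq Sys']
    {dim : Sys → ℕ} {dim' : Sys' → ℕ} (F : Sys → Finset Sys')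
    {X Y : Finset Sys} {X' Y' : Finset Sys'}
    (M : SuperOp dim X Y) (M' : SuperOp dim' X' Y') : Prop where
  inputs_eq : X' = X.biUnion F
  outputs_eq : Y' = Y.biUnion F
  enc_dec : ∃ (Enc : Op dim X →ₗ[ℂ] Op dim' X') (Dec : Op dim' Y' →ₗ[ℂ] Op dim Y),
    IsCPTP Enc ∧ IsCPTPOnImage Dec (M' ∘ₗ Enc) ∧ M = Dec ∘ₗ M' ∘ₗ Enc
  signalling : ∀ A B : Finset Sys, Signals M A B → Signals M' (A.biUnion F) (B.biUnion F)

/-! ### Quantum networks -/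

/-- A finite, possibly cyclic quantum network. `Sys` is the set of in- and output systems, an
output being identified with the input that it is composed with: `src s = some m` says that `s` is
an output of the map `m`, `tgt s = some m` that it is an input of `m`, and `s` is a composition
(output connected to input) when both hold. -/
structure QNetwork where
  Sys : Type
  Map : Type
  [fintypeSys : Fintype Sys]
  [decEqSys : DecidableEq Sys]
  [fintypeMap : Fintype Map]
  [decEqMap : DecidableEq Map]
  dim : Sys → ℕ
  dim_pos : ∀ s, 0 < dim s
  src : Sys → Option Map
  tgt : Sys → Option Map
  attached : ∀ s, src s ≠ none ∨ tgt s ≠ none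
  op : ∀ m : Map, SuperOp dim (Finset.univ.filter fun s => tgt s = some m)
    (Finset.univ.filter fun s => src s = some m)
  op_cp : ∀ m, IsCP (op m)

attribute [instance] QNetwork.fintypeSys QNetwork.decEqSys QNetwork.fintypeMap QNetwork.decEqMap

/-- A sub-network: some of the maps, and some of the compositions between these maps. -/
structure SubNetwork (𝔑 : QNetwork) where
  maps : Finset 𝔑.Map
  comps : Finset 𝔑.Sys
  src_mem : ∀ s ∈ comps, ∃ m ∈ maps, 𝔑.src s = some m
  tgt_mem : ∀ s ∈ comps, ∃ m ∈ maps, 𝔑.tgt s = some m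

namespace SubNetwork

/-- All inputs of the maps of the sub-network. -/
def inputs {𝔑 : QNetwork} (σ : SubNetwork 𝔑) : Finset 𝔑.Sys :=
  Finset.univ.filter fun s => ∃ m ∈ σ.maps, 𝔑.tgt s = some m

/-- All outputs of the maps of the sub-network. -/
def outputs {𝔑 : QNetwork} (σ : SubNetwork 𝔑) : Finset 𝔑.Sys :=
  Finset.univ.filter fun s => ∃ m ∈ σ.maps, 𝔑.src s = some m

/-- Inputs not composed within the sub-network. -/
def freeIn {𝔑 : QNetwork} (σ : SubNetwork 𝔑) : Finset 𝔑.Sys := σ.inputs \ σ.comps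

/-- Outputs not composed within the sub-network. -/
def freeOut {𝔑 : QNetwork} (σ : SubNetwork 𝔑) : Finset 𝔑.Sys := σ.outputs \ σ.comps

theorem mapInputs_subset {𝔑 : QNetwork} (σ : SubNetwork 𝔑) (m : {m // m ∈ σ.maps}) :
    (Finset.univ.filter fun s => 𝔑.tgt s = some m.1) ⊆ σ.inputs := by
  intro s hs
  simp only [inputs, Finset.mem_filter, Finset.mem_univ, true_and] at hs ⊢
  exact ⟨m.1, m.2, hs⟩

theorem mapOutputs_subset {𝔑 : QNetwork} (σ : SubNetwork 𝔑) (m : {m // m ∈ σ.maps}) :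
    (Finset.univ.filter fun s => 𝔑.src s = some m.1) ⊆ σ.outputs := by
  intro s hs
  simp only [outputs, Finset.mem_filter, Finset.mem_univ, true_and] at hs ⊢
  exact ⟨m.1, m.2, hs⟩

theorem comps_subset_inputs {𝔑 : QNetwork} (σ : SubNetwork 𝔑) : σ.comps ⊆ σ.inputs := by
  intro s hs
  simpa [inputs] using σ.tgt_mem s hs

/-- The tensor product of the maps of the sub-network. -/
def tensor {𝔑 : QNetwork} (σ : SubNetwork 𝔑) : SuperOp 𝔑.dim σ.inputs σ.outputs where
  toFun ρ := Matrix.of fun a b => ∑ x : Config 𝔑.dim σ.inputs, ∑ y : Config 𝔑.dim σ.inputs,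
    ρ x y * ∏ m : {m // m ∈ σ.maps},
      𝔑.op m.1 (Matrix.single (restrict (σ.mapInputs_subset m) x)
          (restrict (σ.mapInputs_subset m) y) 1)
        (restrict (σ.mapOutputs_subset m) a) (restrict (σ.mapOutputs_subset m) b)
  map_add' ρ τ := by
    ext a b
    simp [add_mul, Finset.sum_add_distrib]
  map_smul' c ρ := by
    ext a b
    simp [Finset.mul_sum, mul_assoc]

/-- `ρ ⊗ |i⟩⟨j|`, with `ρ` on the free inputs and `|i⟩⟨j|` on the composed inputs. -/
def feed {𝔑 : QNetwork} (σ : SubNetwork 𝔑) (i j : Config 𝔑.dim σ.comps)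
    (ρ : Op 𝔑.dim σ.freeIn) : Op 𝔑.dim σ.inputs :=
  Matrix.of fun x y =>
    ρ (restrict Finset.sdiff_subset x) (restrict Finset.sdiff_subset y) *
      Matrix.single i j (1 : ℂ) (restrict σ.comps_subset_inputs x)
        (restrict σ.comps_subset_inputs y)

/-- The induced map of the sub-network: all its compositions are performed, as loop compositions
`ρ ↦ ∑ i j, ⟨i| (⊗ₘ 𝓜ₘ) (ρ ⊗ |i⟩⟨j|) |j⟩`, on the tensor product of its maps. -/
def induced {𝔑 : QNetwork} (σ : SubNetwork 𝔑) : SuperOp 𝔑.dim σ.freeIn σ.freeOut where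
  toFun ρ := Matrix.of fun a b => ∑ i : Config 𝔑.dim σ.comps, ∑ j : Config 𝔑.dim σ.comps,
    σ.tensor (σ.feed i j ρ) (glue i a) (glue j b)
  map_add' ρ τ := by
    have h : ∀ i j, σ.feed i j (ρ + τ) = σ.feed i j ρ + σ.feed i j τ := by
      intro i j
      ext x y
      simp [feed, add_mul]
    ext a b
    simp [h, Finset.sum_add_distrib]
  map_smul' c ρ := by
    have h : ∀ i j, σ.feed i j (c • ρ) = c • σ.feed i j ρ := by
      intro i j
      ext x y
      simp [feed, mul_assoc]
    ext a b
    simp [h, Finset.mul_sum]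

end SubNetwork

/-- Signalling structure of a network: the signalling relations of the induced maps of all
sub-networks. -/
def NetworkSignals (𝔑 : QNetwork) (A B : Finset 𝔑.Sys) : Prop :=
  ∃ σ : SubNetwork 𝔑, Signals σ.induced A B

/-- `𝔑'` is a fine-graining of `𝔑` relative to the systems fine-graining `F`. -/
structure IsNetworkFineGraining (𝔑 𝔑' : QNetwork) (F : 𝔑.Sys → Finset 𝔑'.Sys) : Prop where
  nonempty : ∀ s, (F s).Nonempty
  disjoint : ∀ s t, s ≠ t → Disjoint (F s) (F t)
  sub : ∀ σ : SubNetwork 𝔑, ∃ σ' : SubNetwork 𝔑', IsFineGraining F σ.induced σ'.induced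

/-! ### Process matrices -/

/-- Basis labels of the joint Hilbert space of one system of each party. -/
abbrev PartyConfig {P : Type} (d : P → ℕ) : Type := ∀ p, Fin (d p)

/-- Operators on all input systems (first factor) and output systems (second factor) of the
parties. -/
abbrev ProcessOp {P : Type} (dI dO : P → ℕ) : Type :=
  Matrix (PartyConfig dI × PartyConfig dO) (PartyConfig dI × PartyConfig dO) ℂ

/-- Local operations from a `k`-dimensional to an `l`-dimensional system. -/
abbrev LocalOp (k l : ℕ) : Type :=
  Matrix (Fin k) (Fin k) ℂ →ₗ[ℂ] Matrix (Fin l) (Fin l) ℂ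

/-- The Choi matrix `∑ i j, |i⟩⟨j| ⊗ f (|i⟩⟨j|)`. -/
def choi {k l : ℕ} (f : LocalOp k l) : Matrix (Fin k × Fin l) (Fin k × Fin l) ℂ :=
  Matrix.of fun p q => f (Matrix.single p.1 q.1 1) p.2 q.2

/-- The tensor product of the Choi matrices of the local operations of the parties. -/
def jointChoi {P : Type} [Fintype P] {dI dO : P → ℕ} (L : ∀ p, LocalOp (dI p) (dO p)) :
    ProcessOp dI dO :=
  Matrix.of fun x y => ∏ p, choi (L p) (x.1 p, x.2 p) (y.1 p, y.2 p)

/-- The probability rule: trace of the (transposed) Choi matrices of the local operations times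
the process matrix. -/
def prob {P : Type} [Fintype P] [DecidableEq P] {dI dO : P → ℕ} (W : ProcessOp dI dO)
    (L : ∀ p, LocalOp (dI p) (dO p)) : ℂ :=
  ((jointChoi L).transpose * W).trace

/-- Valid process matrices: positive, and normalised for every choice of local channels. -/
def IsProcessMatrix {P : Type} [Fintype P] [DecidableEq P] {dI dO : P → ℕ}
    (W : ProcessOp dI dO) : Prop :=
  W.PosSemidef ∧ ∀ L : ∀ p, LocalOp (dI p) (dO p), (∀ p, IsCPTP (L p)) → prob W L = 1

/-- The process map of `W`, from the parties' outputs to the parties' inputs; `W` is its Choi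
matrix. -/
def processMap {P : Type} [Fintype P] [DecidableEq P] {dI dO : P → ℕ} (W : ProcessOp dI dO)
    (ρ : Matrix (PartyConfig dO) (PartyConfig dO) ℂ) :
    Matrix (PartyConfig dI) (PartyConfig dI) ℂ :=
  Matrix.of fun x y => ∑ o, ∑ o', ρ o o' * W (x, o) (y, o')

/-- A family of quantum instruments, one for each of `nS` settings, each with `nX` outcomes. -/
structure Instruments (k l nS nX : ℕ) where
  op : Fin nS → Fin nX → LocalOp k l
  cp : ∀ a x, IsCP (op a x)
  cptp : ∀ a, IsCPTP (∑ x, op a x)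

open Classical in
/-- `W` is a fixed order process: there is a partial order of the parties such that, for all local
instruments and every party `p`, the joint outcome statistics of the parties that are neither `p`
nor in the future of `p` do not depend on the setting of `p`. -/
def IsFixedOrder {P : Type} [Fintype P] [DecidableEq P] {dI dO : P → ℕ}
    (W : ProcessOp dI dO) : Prop :=
  ∃ ord : PartialOrder P, ∀ (nS nX : P → ℕ) (J : ∀ p, Instruments (dI p) (dO p) (nS p) (nX p))
    (p : P) (a a' : ∀ q, Fin (nS q)), (∀ q, q ≠ p → a q = a' q) → ∀ x : (∀ q, Fin (nX q)),
    (∑ z : (∀ q, Fin (nX q)) with ∀ q, ¬ ord.le p q → z q = x q,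
        prob W (fun q => (J q).op (a q) (z q))) =
      ∑ z : (∀ q, Fin (nX q)) with ∀ q, ¬ ord.le p q → z q = x q,
        prob W (fun q => (J q).op (a' q) (z q))

/-! ### Process networks -/

/-- `𝔑` is a process network of `W` over the parties `P`, with possibly communicating labs. Party
`p` has the input system `I p` and the output system `O p`. The sub-network `env` induces the
process map of `W`; it is connected to the remaining maps of `𝔑` exactly through the systems `I p`,
which it emits, and `O p`, which it receives. The remaining maps, with the compositions among them,
are the local operations of the parties; they need not be in tensor product form. -/
structure IsCommunicatingProcessNetwork (𝔑 : QNetwork) {P : Type} [Fintype P] [DecidableEq P]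
    (I O : P → 𝔑.Sys) (env : SubNetwork 𝔑)
    (W : ProcessOp (fun p => 𝔑.dim (I p)) (fun p => 𝔑.dim (O p))) : Prop where
  I_injective : Function.Injective I
  O_injective : Function.Injective O
  full : ∀ s, (∃ m ∈ env.maps, 𝔑.src s = some m) → (∃ m ∈ env.maps, 𝔑.tgt s = some m) →
    s ∈ env.comps
  I_mem : ∀ p, I p ∈ env.freeOut
  O_mem : ∀ p, O p ∈ env.freeIn
  freeOut_eq : ∀ s ∈ env.freeOut, ∃ p, s = I p
  freeIn_eq : ∀ s ∈ env.freeIn, ∃ p, s = O p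
  I_received : ∀ p, ∃ m, m ∉ env.maps ∧ 𝔑.tgt (I p) = some m
  O_sent : ∀ p, ∃ m, m ∉ env.maps ∧ 𝔑.src (O p) = some m
  induced_eq : ∀ ρ : Matrix (PartyConfig fun p => 𝔑.dim (O p))
      (PartyConfig fun p => 𝔑.dim (O p)) ℂ,
    env.induced (ρ.submatrix (fun (x : Config 𝔑.dim env.freeIn) p => x ⟨O p, O_mem p⟩)
        (fun (x : Config 𝔑.dim env.freeIn) p => x ⟨O p, O_mem p⟩)) =
      (processMap W ρ).submatrix (fun (x : Config 𝔑.dim env.freeOut) p => x ⟨I p, I_mem p⟩)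
        (fun (x : Config 𝔑.dim env.freeOut) p => x ⟨I p, I_mem p⟩)

/-- `𝔑` is a process network of `W` over the parties `P`: its maps are the process map and one
local operation `lab p` for each party, and the only compositions are those of the process map with
the local operations through `I p` and `O p`. Local operations may have further free inputs and
outputs (settings, outcomes, ancillas). -/
structure IsProcessNetwork (𝔑 : QNetwork) {P : Type} [Fintype P] [DecidableEq P]
    (I O : P → 𝔑.Sys) (env : SubNetwork 𝔑) (lab : P → 𝔑.Map)
    (W : ProcessOp (fun p => 𝔑.dim (I p)) (fun p => 𝔑.dim (O p))) : Prop extends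
    IsCommunicatingProcessNetwork 𝔑 I O env W where
  env_single : ∃ w, env.maps = {w}
  env_comps : env.comps = ∅
  lab_injective : Function.Injective lab
  lab_not_mem : ∀ p, lab p ∉ env.maps
  map_cases : ∀ m, m ∈ env.maps ∨ ∃ p, m = lab p
  tgt_I : ∀ p, 𝔑.tgt (I p) = some (lab p)
  src_O : ∀ p, 𝔑.src (O p) = some (lab p)
  comp_cases : ∀ s, 𝔑.src s ≠ none → 𝔑.tgt s ≠ none → ∃ p, s = I p ∨ s = O p

/-! ### Spacetime realisations -/

/-- A region precedes another one if some point of it precedes some point of the other. -/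
def RegionPrec {T : Type*} [PartialOrder T] (R₁ R₂ : Set T) : Prop :=
  ∃ p ∈ R₁, ∃ q ∈ R₂, p < q

/-- Edges of the region causal structure whose nodes are the regions in the image of `E`. -/
def RegionEdge {T : Type*} [PartialOrder T] {Sys : Type} (E : Sys → Set T) (R₁ R₂ : Set T) :
    Prop :=
  R₁ ∈ Set.range E ∧ R₂ ∈ Set.range E ∧ RegionPrec R₁ R₂

/-- Directed paths (of length at least one) in the region causal structure. -/
def RegionPath {T : Type*} [PartialOrder T] {Sys : Type} (E : Sys → Set T) :
    Set T → Set T → Prop :=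
  Relation.TransGen (RegionEdge E)

/-- A spacetime realisation of `𝔑` in the spacetime `T`: an embedding of the systems as regions, and
a fine-graining of `𝔑` embedded in sub-regions that partition these regions and have an acyclic
region causal structure. -/
structure SpacetimeRealisation (T : Type*) [PartialOrder T] (𝔑 : QNetwork) where
  embed : 𝔑.Sys → Set T
  fine : QNetwork
  F : 𝔑.Sys → Finset fine.Sys
  isFineGraining : IsNetworkFineGraining 𝔑 fine F
  fineEmbed : fine.Sys → Set T
  cover : ∀ s, embed s = ⋃ t ∈ F s, fineEmbed t
  disjoint : ∀ s, ∀ t ∈ F s, ∀ t' ∈ F s, t ≠ t' → Disjoint (fineEmbed t) (fineEmbed t')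
  acyclic : ∀ R, ¬ RegionPath fineEmbed R R

namespace SpacetimeRealisation

/-- Relativistic causality: signalling between disjoint sets of fine-grained systems requires a
directed path between their regions. -/
def RelativisticCausality {T : Type*} [PartialOrder T] {𝔑 : QNetwork}
    (R : SpacetimeRealisation T 𝔑) : Prop :=
  ∀ A B : Finset R.fine.Sys, Disjoint A B → B.Nonempty → NetworkSignals R.fine A B →
    ∃ s ∈ A, ∃ t ∈ B, RegionPath R.fineEmbed (R.fineEmbed s) (R.fineEmbed t)

/-- Input-output correspondence: the region of each party's input and the region of its output are
partitioned into equally many sub-regions, matched so that each input sub-region precedes the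
corresponding output sub-region. -/
def InputOutputCorrespondence {T : Type*} [PartialOrder T] {𝔑 : QNetwork}
    (R : SpacetimeRealisation T 𝔑) {P : Type} (I O : P → 𝔑.Sys) : Prop :=
  ∀ p, ∃ β : {t // t ∈ R.F (I p)} ≃ {t // t ∈ R.F (O p)},
    ∀ t, RegionPrec (R.fineEmbed t.1) (R.fineEmbed (β t).1)

end SpacetimeRealisation

end QCausal

end

open scoped ComplexOrder

noncomputable section

namespace QCausal

/-! ### Choi matrices and the reset channel -/

/-- Discard the input and prepare the basis state `z`. -/
def reset {α β : Type} [Fintype α] [DecidableEq β] (z : β) :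
    Matrix α α ℂ →ₗ[ℂ] Matrix β β ℂ where
  toFun ρ := ρ.trace • Matrix.single z z 1
  map_add' ρ τ := by rw [Matrix.trace_add, add_smul]
  map_smul' c ρ := by rw [Matrix.trace_smul, smul_assoc, RingHom.id_apply]

theorem reset_apply {α β : Type} [Fintype α] [DecidableEq β] (z : β) (ρ : Matrix α α ℂ) :
    reset z ρ = ρ.trace • Matrix.single z z (1 : ℂ) := rfl

theorem trace_reset {α β : Type} [Fintype α] [Fintype β] [DecidableEq β] (z : β)
    (ρ : Matrix α α ℂ) : (reset z ρ).trace = ρ.trace := by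
  rw [reset_apply, Matrix.trace_smul, Matrix.trace_single_eq_same, smul_eq_mul, mul_one]

theorem posSemidef_hadamard {α : Type} {A B : Matrix α α ℂ} (hA : A.PosSemidef)
    (hB : B.PosSemidef) : (Matrix.of fun x y => A x y * B x y).PosSemidef := by
  exact hA.hadamard hB

theorem posSemidef_outer {α : Type} [Finite α] (v : α → ℂ) :
    (Matrix.of fun x y => v x * star (v y)).PosSemidef :=
  Matrix.posSemidef_vecMulVec_self_star v

theorem isCPTP_reset {α β : Type} [Fintype α] [Fintype β] [DecidableEq β] (z : β) :
    IsCPTP (reset (α := α) z) := by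
  refine ⟨fun n ρ hρ => ?_, trace_reset z⟩
  have h : amplify n (reset z) ρ = ∑ x : α, Matrix.of fun p q : Fin n × β =>
      ρ.submatrix (fun p : Fin n × β => (p.1, x)) (fun p => (p.1, x)) p q *
        (Matrix.of fun p q : Fin n × β => (if z = p.2 then (1 : ℂ) else 0) *
          star (if z = q.2 then (1 : ℂ) else 0)) p q := by
    ext p q
    rw [Matrix.sum_apply]
    simp only [amplify, Matrix.of_apply, reset_apply, Matrix.smul_apply, smul_eq_mul,
      Matrix.submatrix_apply, Matrix.trace, Matrix.diag_apply, ← Finset.sum_mul]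
    congr 1
    by_cases h₁ : z = p.2 <;> by_cases h₂ : z = q.2 <;> simp [Matrix.single_apply, h₁, h₂]
  rw [h]
  exact Matrix.posSemidef_sum _ fun x _ =>
    posSemidef_hadamard (hρ.submatrix _) (posSemidef_outer _)

theorem IsCP.posSemidef_choi {α β : Type} [Fintype α] [DecidableEq α]
    {f : Matrix α α ℂ →ₗ[ℂ] Matrix β β ℂ} (hf : IsCP f) :
    (Matrix.of fun u v : α × β => f (Matrix.single u.1 v.1 1) u.2 v.2).PosSemidef := by
  let e := Fintype.equivFin α
  have h := (hf (Fintype.card α) _ (posSemidef_outer fun p : Fin (Fintype.card α) × α =>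
    if e p.2 = p.1 then (1 : ℂ) else 0)).submatrix (Prod.map e id : α × β → _)
  convert h using 1
  ext u v
  simp only [amplify, Matrix.submatrix_apply, Matrix.of_apply, Prod.map_fst, Prod.map_snd, id]
  refine congrFun (congrFun (congrArg f ?_) _) _
  ext x y
  have h₁ : e x = e u.1 ↔ u.1 = x := e.apply_eq_iff_eq.trans eq_comm
  have h₂ : e y = e v.1 ↔ v.1 = y := e.apply_eq_iff_eq.trans eq_comm
  simp only [Matrix.of_apply, Matrix.single_apply, h₁, h₂]
  by_cases h₃ : u.1 = x <;> by_cases h₄ : v.1 = y <;> simp [h₃, h₄]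

theorem posSemidef_blockSum {α ι : Type} [Finite α] [Fintype ι]
    {S : Matrix (α × ι) (α × ι) ℂ} (hS : S.PosSemidef) :
    (Matrix.of fun u v => ∑ i, ∑ j, S (u, i) (v, j)).PosSemidef := by
  classical
  have := Fintype.ofFinite α
  have h := hS.conjTranspose_mul_mul_same
    (Matrix.of fun (p : α × ι) (v : α) => if p.1 = v then (1 : ℂ) else 0)
  convert h using 1
  ext u v
  simp only [Matrix.of_apply, Matrix.mul_apply, Matrix.conjTranspose_apply, Fintype.sum_prod_type,
    apply_ite (star : ℂ → ℂ), star_one, star_zero, ite_mul, one_mul, zero_mul, mul_ite, mul_one,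
    mul_zero]
  rw [Finset.sum_eq_single v (by simp +contextual) (by simp), Finset.sum_comm]
  refine Finset.sum_congr rfl fun j _ => ?_
  rw [if_pos rfl, Finset.sum_eq_single u (by simp +contextual) (by simp)]
  simp

theorem posSemidef_prod {α ι : Type} [Finite α] (s : Finset ι) (A : ι → Matrix α α ℂ)
    (h : ∀ i, (A i).PosSemidef) : (Matrix.of fun x y => ∏ i ∈ s, A i x y).PosSemidef := by
  classical
  induction s using Finset.induction_on with
  | empty => simpa using posSemidef_outer fun _ : α => (1 : ℂ)
  | insert i s hi ih => simpa [Finset.prod_insert hi] using posSemidef_hadamard (h i) ih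

/-! ### Joint configurations -/

theorem glue_of_mem {Sys : Type} [DecidableEq Sys] {dim : Sys → ℕ} {A X : Finset Sys}
    (u : Config dim A) (v : Config dim (X \ A)) (s : {s // s ∈ X}) (h : s.1 ∈ A) :
    glue u v s = u ⟨s.1, h⟩ := dif_pos h

theorem glue_of_not_mem {Sys : Type} [DecidableEq Sys] {dim : Sys → ℕ} {A X : Finset Sys}
    (u : Config dim A) (v : Config dim (X \ A)) (s : {s // s ∈ X}) (h : s.1 ∉ A) :
    glue u v s = v ⟨s.1, Finset.mem_sdiff.mpr ⟨s.2, h⟩⟩ := dif_neg h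

/-- Splitting a basis label of `X` into one of `A` and one of `X \ A`. -/
def glueEquiv {Sys : Type} [DecidableEq Sys] (dim : Sys → ℕ) {A X : Finset Sys} (h : A ⊆ X) :
    Config dim A × Config dim (X \ A) ≃ Config dim X where
  toFun p := glue p.1 p.2
  invFun x := (restrict h x, restrict Finset.sdiff_subset x)
  left_inv p := by
    refine Prod.ext (funext fun s => ?_) (funext fun s => ?_)
    · exact glue_of_mem _ _ ⟨s.1, h s.2⟩ s.2
    · exact glue_of_not_mem _ _ ⟨s.1, (Finset.mem_sdiff.mp s.2).1⟩ (Finset.mem_sdiff.mp s.2).2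
  right_inv x := by
    funext s
    by_cases hs : s.1 ∈ A
    · exact glue_of_mem _ _ _ hs
    · exact glue_of_not_mem _ _ _ hs

theorem eq_glue_iff {Sys : Type} [DecidableEq Sys] {dim : Sys → ℕ} {A X : Finset Sys}
    (h : A ⊆ X) (u : Config dim A) (v : Config dim (X \ A)) (x : Config dim X) :
    glue u v = x ↔ v = restrict Finset.sdiff_subset x ∧ u = restrict h x := by
  rw [and_comm, ← Prod.mk.injEq]
  exact Iff.symm ((glueEquiv dim h).eq_symm_apply (y := (u, v)))

theorem sum_glue {Sys : Type} [DecidableEq Sys] {dim : Sys → ℕ} {A X : Finset Sys}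
    (h : A ⊆ X) (f : Config dim X → ℂ) :
    ∑ x, f x = ∑ u : Config dim A, ∑ v : Config dim (X \ A), f (glue u v) := by
  rw [← (glueEquiv dim h).sum_comp, Fintype.sum_prod_type]
  rfl

theorem trace_reduce {Sys : Type} [DecidableEq Sys] {dim : Sys → ℕ} {B Y : Finset Sys}
    (h : B ⊆ Y) (σ : Op dim Y) : (reduce B σ).trace = σ.trace := by
  simp only [Matrix.trace, Matrix.diag_apply, reduce, Matrix.of_apply]
  exact (sum_glue h fun x => σ x x).symm

/-! ### Positivity of induced maps -/

namespace SubNetwork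

theorem tensor_single {𝔑 : QNetwork} (σ : SubNetwork 𝔑) (x y : Config 𝔑.dim σ.inputs)
    (a b : Config 𝔑.dim σ.outputs) :
    σ.tensor (Matrix.single x y 1) a b = ∏ m : {m // m ∈ σ.maps},
      𝔑.op m.1 (Matrix.single (restrict (σ.mapInputs_subset m) x)
          (restrict (σ.mapInputs_subset m) y) 1)
        (restrict (σ.mapOutputs_subset m) a) (restrict (σ.mapOutputs_subset m) b) := by
  change ∑ x' : Config 𝔑.dim σ.inputs, ∑ y' : Config 𝔑.dim σ.inputs, _ = _
  rw [Finset.sum_eq_single x, Finset.sum_eq_single y]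
  · simp
  · intro y' _ hy
    simp [hy.symm]
  · simp
  · intro x' _ hx
    simp [hx.symm]
  · simp

theorem feed_single {𝔑 : QNetwork} (σ : SubNetwork 𝔑) (i j : Config 𝔑.dim σ.comps)
    (x y : Config 𝔑.dim σ.freeIn) :
    σ.feed i j (Matrix.single x y 1) =
      Matrix.single (glue (X := σ.inputs) i x) (glue (X := σ.inputs) j y) 1 := by
  ext x' y'
  have hx := eq_glue_iff (X := σ.inputs) σ.comps_subset_inputs i x x'
  have hy := eq_glue_iff (X := σ.inputs) σ.comps_subset_inputs j y y'
  simp only [feed, Matrix.of_apply, Matrix.single_apply, hx, hy, mul_ite, mul_one, mul_zero,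
    ← ite_and]
  exact if_congr (by tauto) rfl rfl

theorem induced_single {𝔑 : QNetwork} (σ : SubNetwork 𝔑) (x y : Config 𝔑.dim σ.freeIn)
    (a b : Config 𝔑.dim σ.freeOut) :
    σ.induced (Matrix.single x y 1) a b = ∑ i : Config 𝔑.dim σ.comps,
      ∑ j : Config 𝔑.dim σ.comps, σ.tensor
        (Matrix.single (glue (X := σ.inputs) i x) (glue (X := σ.inputs) j y) 1)
        (glue i a) (glue j b) := by
  change ∑ i : Config 𝔑.dim σ.comps, ∑ j : Config 𝔑.dim σ.comps, _ = _
  simp only [feed_single]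

theorem posSemidef_choi_tensor {𝔑 : QNetwork} (σ : SubNetwork 𝔑) :
    (Matrix.of fun u v : Config 𝔑.dim σ.inputs × Config 𝔑.dim σ.outputs =>
      σ.tensor (Matrix.single u.1 v.1 1) u.2 v.2).PosSemidef := by
  have h := posSemidef_prod Finset.univ _ fun m : {m // m ∈ σ.maps} =>
    (𝔑.op_cp m.1).posSemidef_choi.submatrix
      fun u : Config 𝔑.dim σ.inputs × Config 𝔑.dim σ.outputs =>
        (restrict (σ.mapInputs_subset m) u.1, restrict (σ.mapOutputs_subset m) u.2)
  convert h using 1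
  ext u v
  rw [Matrix.of_apply, tensor_single]
  rfl

theorem posSemidef_choi_induced {𝔑 : QNetwork} (σ : SubNetwork 𝔑) :
    (Matrix.of fun u v : Config 𝔑.dim σ.freeIn × Config 𝔑.dim σ.freeOut =>
      σ.induced (Matrix.single u.1 v.1 1) u.2 v.2).PosSemidef := by
  have h := posSemidef_blockSum (σ.posSemidef_choi_tensor.submatrix
    fun p : (Config 𝔑.dim σ.freeIn × Config 𝔑.dim σ.freeOut) × Config 𝔑.dim σ.comps =>
      (glue (X := σ.inputs) p.2 p.1.1, glue (X := σ.outputs) p.2 p.1.2))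
  convert h using 1
  ext u v
  rw [Matrix.of_apply, induced_single]
  rfl

end SubNetwork

/-! ### Process matrices of maps -/

/-- Joint basis labels of the parties, each holding one of the systems in `X`. -/
def labelEquiv {Sys P : Type} (dim : Sys → ℕ) {X : Finset Sys} (e : P ≃ {s // s ∈ X}) :
    PartyConfig (fun p => dim (e p).1) ≃ Config dim X :=
  Equiv.piCongrLeft (fun s : {s // s ∈ X} => Fin (dim s.1)) e

theorem labelEquiv_apply {Sys P : Type} {dim : Sys → ℕ} {X : Finset Sys} (e : P ≃ {s // s ∈ X})
    (u : PartyConfig fun p => dim (e p).1) (p : P) : labelEquiv dim e u (e p) = u p :=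
  Equiv.piCongrLeft_apply_apply (fun s : {s // s ∈ X} => Fin (dim s.1)) e u p

/-- The Choi matrix of `M`, read as a process matrix of parties with inputs `Y` and outputs `X`. -/
def processOfMap {Sys P : Type} [DecidableEq Sys] {dim : Sys → ℕ} {X Y : Finset Sys}
    (eI : P ≃ {s // s ∈ Y}) (eO : P ≃ {s // s ∈ X}) (M : SuperOp dim X Y) :
    ProcessOp (fun p => dim (eI p).1) (fun p => dim (eO p).1) :=
  Matrix.of fun u v => M (Matrix.single (labelEquiv dim eO u.2) (labelEquiv dim eO v.2) 1)
    (labelEquiv dim eI u.1) (labelEquiv dim eI v.1)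

/-- The operators `⊗ₚ Lₚ(|xₚ⟩⟨yₚ|)`. -/
def localTensor {Sys P : Type} [Fintype P] {dim : Sys → ℕ} {X Y : Finset Sys}
    (eI : P ≃ {s // s ∈ Y}) (eO : P ≃ {s // s ∈ X})
    (L : ∀ p, LocalOp (dim (eI p).1) (dim (eO p).1)) (x y : Config dim Y) : Op dim X :=
  Matrix.of fun a b =>
    ∏ p, L p (Matrix.single (x (eI p)) (y (eI p)) 1) (a (eO p)) (b (eO p))

/-- The restriction of the basis label `z` to the systems in `X`. -/
abbrev baseLabel {Sys : Type} {dim : Sys → ℕ} (z : ∀ s, Fin (dim s)) (X : Finset Sys) :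
    Config dim X :=
  fun s => z s.1

theorem map_apply_eq_sum {α β : Type} [Fintype α] [DecidableEq α]
    (f : Matrix α α ℂ →ₗ[ℂ] Matrix β β ℂ) (ρ : Matrix α α ℂ) (x y : β) :
    f ρ x y = ∑ a, ∑ b, ρ a b * f (Matrix.single a b 1) x y := by
  conv_lhs => rw [Matrix.matrix_eq_sum_single ρ]
  simp only [map_sum, Matrix.sum_apply]
  refine Finset.sum_congr rfl fun a _ => Finset.sum_congr rfl fun b _ => ?_
  rw [← mul_one (ρ a b), ← smul_eq_mul, ← Matrix.smul_single, map_smul]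
  simp

theorem prob_eq_sum {P : Type} [Fintype P] [DecidableEq P] {dI dO : P → ℕ} (W : ProcessOp dI dO)
    (L : ∀ p, LocalOp (dI p) (dO p)) :
    prob W L = ∑ v, ∑ u, (∏ p, choi (L p) (u.1 p, u.2 p) (v.1 p, v.2 p)) * W u v := by
  rfl

theorem prob_processOfMap {Sys P : Type} [DecidableEq Sys] [Fintype P] [DecidableEq P]
    {dim : Sys → ℕ} {X Y : Finset Sys} (eI : P ≃ {s // s ∈ Y}) (eO : P ≃ {s // s ∈ X})
    (M : SuperOp dim X Y) (L : ∀ p, LocalOp (dim (eI p).1) (dim (eO p).1)) :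
    prob (processOfMap eI eO M) L = ∑ x, ∑ y, M (localTensor eI eO L x y) x y := by
  rw [prob_eq_sum, Finset.sum_comm]
  simp only [Fintype.sum_prod_type]
  rw [← (labelEquiv dim eI).sum_comp]
  refine Finset.sum_congr rfl fun x _ => ?_
  rw [Finset.sum_comm, ← (labelEquiv dim eI).sum_comp]
  refine Finset.sum_congr rfl fun y _ => ?_
  rw [map_apply_eq_sum, ← (labelEquiv dim eO).sum_comp]
  refine Finset.sum_congr rfl fun a _ => ?_
  rw [← (labelEquiv dim eO).sum_comp]
  refine Finset.sum_congr rfl fun b _ => ?_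
  simp only [processOfMap, localTensor, choi, Matrix.of_apply, labelEquiv_apply]

theorem reset_comp {α β γ : Type} [Fintype α] [Fintype β] [DecidableEq γ] (z : γ)
    (f : Matrix α α ℂ →ₗ[ℂ] Matrix β β ℂ) (hf : ∀ ρ, (f ρ).trace = ρ.trace) :
    reset z ∘ₗ f = reset z :=
  LinearMap.ext fun ρ => by rw [LinearMap.comp_apply, reset_apply, reset_apply, hf]

theorem reset_single {α β : Type} [Fintype α] [DecidableEq α] [DecidableEq β] (z : β) (x y : α) :
    reset z (Matrix.single x y (1 : ℂ)) = if x = y then Matrix.single z z 1 else 0 := by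
  rw [reset_apply]
  split_ifs with h
  · rw [h, Matrix.trace_single_eq_same, one_smul]
  · rw [Matrix.trace_single_eq_of_ne _ _ _ h, zero_smul]

theorem singleton_eval_bijective {Sys : Type} (dim : Sys → ℕ) (s : Sys) :
    Function.Bijective fun u : Config dim {s} => u ⟨s, Finset.mem_singleton_self s⟩ := by
  constructor
  · intro u v h
    funext ⟨t, ht⟩
    obtain rfl := Finset.mem_singleton.mp ht
    exact h
  · exact fun t => ⟨fun r => Fin.cast (by rw [Finset.mem_singleton.mp r.2]) t, rfl⟩

theorem applyOn_reset {Sys : Type} [DecidableEq Sys] {dim : Sys → ℕ} {A X : Finset Sys}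
    (h : A ⊆ X) (z : Config dim A) (ρ : Op dim X) (x y : Config dim X) :
    applyOn h (reset z) ρ x y =
      (∑ u : Config dim A, ρ (glue u (restrict Finset.sdiff_subset x))
        (glue u (restrict Finset.sdiff_subset y))) *
        if z = restrict h x ∧ z = restrict h y then 1 else 0 := rfl

theorem applyOn_reset_localTensor {Sys P : Type} [DecidableEq Sys] [Fintype P] [DecidableEq P]
    {dim : Sys → ℕ} {X Y : Finset Sys} (eI : P ≃ {s // s ∈ Y}) (eO : P ≃ {s // s ∈ X})
    (z : ∀ s, Fin (dim s)) (L : ∀ p, LocalOp (dim (eI p).1) (dim (eO p).1)) (p : P)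
    (h : {(eO p).1} ⊆ X) (x y : Config dim Y) :
    applyOn h (reset (baseLabel z _)) (localTensor eI eO L x y) =
      localTensor eI eO (Function.update L p (reset (z (eO p).1) ∘ₗ L p)) x y := by
  ext a b
  have hz : ∀ c : Config dim X, baseLabel z {(eO p).1} =
      restrict h c ↔ z (eO p).1 = c (eO p) := fun c =>
    (singleton_eval_bijective dim (eO p).1).injective.eq_iff.symm
  have hne : ∀ (u : Config dim {(eO p).1}) (c : Config dim X) (q : P), q ≠ p →
      glue u (restrict Finset.sdiff_subset c) (eO q) = c (eO q) := fun u c q hq =>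
    glue_of_not_mem _ _ _ fun hm =>
      hq (eO.injective (Subtype.ext (Finset.mem_singleton.mp hm)))
  have heq : ∀ (u : Config dim {(eO p).1}) (c : Config dim X),
      glue u (restrict Finset.sdiff_subset c) (eO p) = u ⟨_, Finset.mem_singleton_self _⟩ :=
    fun u c => glue_of_mem _ _ _ (Finset.mem_singleton_self _)
  rw [applyOn_reset]
  simp only [hz, localTensor, Matrix.of_apply]
  rw [Fintype.prod_eq_mul_prod_compl p]
  simp only [Fintype.prod_eq_mul_prod_compl p, Function.update_self, heq]
  rw [LinearMap.comp_apply, reset_apply, Matrix.smul_apply, Matrix.single_apply, smul_eq_mul,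
    Matrix.trace, ← (singleton_eval_bijective dim (eO p).1).sum_comp (fun t =>
      Matrix.diag (L p (Matrix.single (x (eI p)) (y (eI p)) 1)) t), mul_right_comm]
  congr 1
  rw [Finset.sum_mul]
  refine Finset.sum_congr rfl fun u _ => ?_
  congr 1
  refine Finset.prod_congr rfl fun q hq => ?_
  have hq : q ≠ p := by simpa using hq
  rw [hne u a q hq, hne u b q hq, Function.update_of_ne hq]

theorem reduce_eq_of_not_signals {Sys : Type} [DecidableEq Sys] {dim : Sys → ℕ}
    {A B X Y : Finset Sys} {M : SuperOp dim X Y} (h : ¬ Signals M A B) (hB : B ⊆ Y) (hA : A ⊆ X)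
    {N : SuperOp dim A A} (hN : IsCPTP N) (ρ : Op dim X) :
    reduce B (M (applyOn hA N ρ)) = reduce B (M ρ) := by
  by_contra hne
  exact h ⟨hB, hA, N, hN, ρ, Ne.symm hne⟩

/-- The inputs of the parties outside `U`. -/
def inputsOff {Sys P : Type} [DecidableEq Sys] [Fintype P] [DecidableEq P] {Y : Finset Sys}
    (eI : P ≃ {s // s ∈ Y}) (U : Finset P) : Finset Sys :=
  Uᶜ.image fun q => (eI q).1

theorem inputsOff_subset {Sys P : Type} [DecidableEq Sys] [Fintype P] [DecidableEq P]
    {Y : Finset Sys} (eI : P ≃ {s // s ∈ Y}) (U : Finset P) : inputsOff eI U ⊆ Y :=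
  Finset.image_subset_iff.mpr fun q _ => (eI q).2

theorem mem_inputsOff {Sys P : Type} [DecidableEq Sys] [Fintype P] [DecidableEq P]
    {Y : Finset Sys} (eI : P ≃ {s // s ∈ Y}) (U : Finset P) (q : P) :
    (eI q).1 ∈ inputsOff eI U ↔ q ∉ U := by
  simp [inputsOff]

theorem localTensor_glue {Sys P : Type} [DecidableEq Sys] [Fintype P] [DecidableEq P]
    {dim : Sys → ℕ} {X Y : Finset Sys} (eI : P ≃ {s // s ∈ Y}) (eO : P ≃ {s // s ∈ X})
    (z : ∀ s, Fin (dim s)) (L : ∀ p, LocalOp (dim (eI p).1) (dim (eO p).1)) (U : Finset P)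
    (hL : ∀ q ∈ U, L q = reset (z (eO q).1)) (a b : Config dim (inputsOff eI U))
    (c d : Config dim (Y \ inputsOff eI U)) :
    localTensor eI eO L (glue a c) (glue b d) =
      if c = d then localTensor eI eO L (glue a (baseLabel z _)) (glue b (baseLabel z _))
      else 0 := by
  ext o o'
  split_ifs with h
  · subst h
    simp only [localTensor, Matrix.of_apply]
    refine Finset.prod_congr rfl fun q _ => ?_
    by_cases hq : q ∈ U
    · have hq' : (eI q).1 ∉ inputsOff eI U := fun hm => (mem_inputsOff eI U q).mp hm hq
      simp only [hL q hq, reset_single, glue_of_not_mem _ _ (eI q) hq', if_true]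
    · have hq' := (mem_inputsOff eI U q).mpr hq
      simp only [glue_of_mem _ _ (eI q) hq']
  · obtain ⟨s, hs⟩ := Function.ne_iff.mp h
    obtain ⟨hsY, hsU⟩ := Finset.mem_sdiff.mp s.2
    obtain ⟨q, hq⟩ := eI.surjective ⟨s.1, hsY⟩
    have hqs : (eI q).1 = s.1 := congrArg Subtype.val hq
    have hqU : q ∈ U := by
      by_contra hn
      exact hsU (hqs ▸ (mem_inputsOff eI U q).mpr hn)
    refine Finset.prod_eq_zero (Finset.mem_univ q) ?_
    rw [hL q hqU, reset_single, if_neg, Matrix.zero_apply]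
    rw [hq, glue_of_not_mem a c ⟨s.1, hsY⟩ hsU, glue_of_not_mem b d ⟨s.1, hsY⟩ hsU]
    exact hs

theorem prob_eq_sum_reduce {Sys P : Type} [DecidableEq Sys] [Fintype P] [DecidableEq P]
    {dim : Sys → ℕ} {X Y : Finset Sys} (eI : P ≃ {s // s ∈ Y}) (eO : P ≃ {s // s ∈ X})
    (M : SuperOp dim X Y) (z : ∀ s, Fin (dim s))
    (L : ∀ p, LocalOp (dim (eI p).1) (dim (eO p).1)) (U : Finset P)
    (hL : ∀ q ∈ U, L q = reset (z (eO q).1)) :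
    prob (processOfMap eI eO M) L = ∑ a, ∑ b, reduce (inputsOff eI U)
      (M (localTensor eI eO L (glue a (baseLabel z _)) (glue b (baseLabel z _)))) a b := by
  rw [prob_processOfMap, sum_glue (inputsOff_subset eI U)]
  refine Finset.sum_congr rfl fun a _ => ?_
  simp only [reduce, Matrix.of_apply]
  conv_rhs => rw [Finset.sum_comm]
  refine Finset.sum_congr rfl fun c _ => ?_
  rw [sum_glue (inputsOff_subset eI U)]
  refine Finset.sum_congr rfl fun b _ => ?_
  rw [Finset.sum_eq_single c, localTensor_glue eI eO z L U hL, if_pos rfl]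
  · intro d _ hd
    rw [localTensor_glue eI eO z L U hL, if_neg hd.symm, map_zero, Matrix.zero_apply]
  · simp

theorem prob_update_reset {Sys P : Type} [DecidableEq Sys] [Fintype P] [DecidableEq P]
    {dim : Sys → ℕ} {X Y : Finset Sys} (eI : P ≃ {s // s ∈ Y}) (eO : P ≃ {s // s ∈ X})
    (M : SuperOp dim X Y) (z : ∀ s, Fin (dim s))
    (L : ∀ p, LocalOp (dim (eI p).1) (dim (eO p).1)) (U : Finset P)
    (hL : ∀ q ∈ U, L q = reset (z (eO q).1)) (p : P) (hp : p ∉ U)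
    (hns : ¬ Signals M {(eO p).1} (inputsOff eI U)) :
    prob (processOfMap eI eO M) (Function.update L p (reset (z (eO p).1) ∘ₗ L p)) =
      prob (processOfMap eI eO M) L := by
  have hA : {(eO p).1} ⊆ X := Finset.singleton_subset_iff.mpr (eO p).2
  rw [prob_eq_sum_reduce eI eO M z L U hL, prob_eq_sum_reduce eI eO M z _ U]
  · simp only [← applyOn_reset_localTensor eI eO z L p hA,
      reduce_eq_of_not_signals hns (inputsOff_subset eI U) hA (isCPTP_reset _)]
  · intro q hq
    rw [Function.update_of_ne (ne_of_mem_of_not_mem hq hp), hL q hq]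

/-- If no party signals outside its future, the operations of the parties in an upper set can be
replaced by resets. -/
theorem prob_reset_upper {Sys P : Type} [DecidableEq Sys] [Fintype P] [DecidableEq P]
    [PartialOrder P] {dim : Sys → ℕ} {X Y : Finset Sys} (eI : P ≃ {s // s ∈ Y})
    (eO : P ≃ {s // s ∈ X}) (M : SuperOp dim X Y) (z : ∀ s, Fin (dim s))
    (hns : ∀ (p : P) (U : Finset P), p ∉ U → (∀ q, p < q → q ∈ U) →
      ¬ Signals M {(eO p).1} (inputsOff eI U))
    (L : ∀ p, LocalOp (dim (eI p).1) (dim (eO p).1)) (U : Finset P)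
    (hU : ∀ p ∈ U, ∀ q, p ≤ q → q ∈ U) (hL : ∀ p ∈ U, ∀ ρ, (L p ρ).trace = ρ.trace) :
    prob (processOfMap eI eO M) (fun q => if q ∈ U then reset (z (eO q).1) else L q) =
      prob (processOfMap eI eO M) L := by
  induction U using Finset.strongInduction with
  | H U ih =>
    obtain rfl | hne := U.eq_empty_or_nonempty
    · simp
    obtain ⟨p, hp, hmin⟩ := U.exists_minimal hne
    have ih' := ih (U.erase p) (Finset.erase_ssubset hp)
      (fun q hq r hqr => Finset.mem_erase.mpr ⟨fun hrp => (Finset.mem_erase.mp hq).1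
          (le_antisymm (hrp ▸ hqr) (hmin (Finset.mem_of_mem_erase hq) (hrp ▸ hqr))),
        hU q (Finset.mem_of_mem_erase hq) r hqr⟩)
      (fun q hq => hL q (Finset.mem_of_mem_erase hq))
    rw [← ih', ← prob_update_reset eI eO M z _ (U.erase p) (fun q hq => if_pos hq) p
      (Finset.notMem_erase p U) (hns p _ (Finset.notMem_erase p U) fun q hq =>
        Finset.mem_erase.mpr ⟨hq.ne', hU p hp q hq.le⟩)]
    congr 1
    funext q
    by_cases hq : q = p
    · subst hq
      rw [Function.update_self, if_pos hp, if_neg (Finset.notMem_erase q U),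
        reset_comp _ _ (hL q hp)]
    · rw [Function.update_of_ne hq]
      simp [hq]

theorem localTensor_reset {Sys P : Type} [DecidableEq Sys] [Fintype P] {dim : Sys → ℕ}
    {X Y : Finset Sys} (eI : P ≃ {s // s ∈ Y}) (eO : P ≃ {s // s ∈ X}) (z : ∀ s, Fin (dim s))
    (x y : Config dim Y) :
    localTensor eI eO (fun p => reset (z (eO p).1)) x y =
      if x = y then Matrix.single (baseLabel z X) (baseLabel z X) 1 else 0 := by
  ext a b
  simp only [localTensor, reset_single, Matrix.of_apply]
  split_ifs with h
  · subst h
    simp only [if_true, Matrix.single_apply, Finset.prod_ite_zero, Finset.prod_const_one,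
      Finset.mem_univ, forall_true_left]
    refine if_congr ?_ rfl rfl
    rw [forall_and, funext_iff, funext_iff]
    exact and_congr (eO.surjective.forall (p := fun s => z s.1 = a s)).symm
      (eO.surjective.forall (p := fun s => z s.1 = b s)).symm
  · obtain ⟨s, hs⟩ := Function.ne_iff.mp h
    obtain ⟨q, rfl⟩ := eI.surjective s
    refine Finset.prod_eq_zero (Finset.mem_univ q) ?_
    rw [if_neg hs, Matrix.zero_apply]

theorem prob_reset {Sys P : Type} [DecidableEq Sys] [Fintype P] [DecidableEq P]
    {dim : Sys → ℕ} {X Y : Finset Sys} (eI : P ≃ {s // s ∈ Y}) (eO : P ≃ {s // s ∈ X})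
    (M : SuperOp dim X Y) (z : ∀ s, Fin (dim s)) :
    prob (processOfMap eI eO M) (fun p => reset (z (eO p).1)) =
      (M (Matrix.single (baseLabel z X) (baseLabel z X) 1)).trace := by
  rw [prob_processOfMap, Matrix.trace]
  refine Finset.sum_congr rfl fun x _ => ?_
  simp only [localTensor_reset]
  rw [Finset.sum_eq_single x, if_pos rfl, Matrix.diag_apply]
  · intro y _ hy
    rw [if_neg hy.symm, map_zero, Matrix.zero_apply]
  · simp

/-! ### Trace scaling -/

theorem applyOn_reset_single {Sys : Type} [DecidableEq Sys] {dim : Sys → ℕ} {A X : Finset Sys}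
    (h : A ⊆ X) (z : Config dim A) (x y : Config dim X) :
    applyOn h (reset z) (Matrix.single x y 1) =
      if restrict h x = restrict h y then
        Matrix.single (glue z (restrict Finset.sdiff_subset x))
          (glue z (restrict Finset.sdiff_subset y)) 1
      else 0 := by
  ext a b
  have hg : ∀ (u : Config dim A) (v w : Config dim X),
      w = glue u (restrict Finset.sdiff_subset v) ↔
        restrict Finset.sdiff_subset v = restrict Finset.sdiff_subset w ∧ u = restrict h w :=
    fun u v w => eq_comm.trans (eq_glue_iff h u _ w)
  rw [applyOn_reset, apply_ite (fun m : Op dim X => m a b)]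
  simp only [Matrix.single_apply, eq_glue_iff h, hg, Matrix.zero_apply]
  rw [Finset.sum_eq_single (restrict h x)]
  · by_cases hxy : restrict h x = restrict h y <;> simp only [hxy, true_and, and_true, if_false,
      and_false, zero_mul, ite_mul, one_mul, ← ite_and, false_and]
    refine if_congr ?_ rfl rfl
    rw [eq_comm (a := restrict Finset.sdiff_subset a), eq_comm (a := restrict Finset.sdiff_subset b)]
    tauto
  · intro u _ hu
    rw [if_neg fun hc => hu hc.1.2]
  · simp

theorem eq_diagonal_of_eq_update {ι : Type} [Fintype ι] [DecidableEq ι] {d : ι → ℕ}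
    (z : ∀ i, Fin (d i)) (t : (∀ i, Fin (d i)) → (∀ i, Fin (d i)) → ℂ)
    (ht : ∀ i x y, t x y =
      if x i = y i then t (Function.update x i (z i)) (Function.update y i (z i)) else 0)
    (x y : ∀ i, Fin (d i)) : t x y = if x = y then t z z else 0 := by
  split_ifs with h
  · subst h
    have key : ∀ S : Finset ι, t x x = t (S.piecewise z x) (S.piecewise z x) := by
      intro S
      induction S using Finset.induction_on with
      | empty => simp
      | insert i S _ ih => rw [ih, ht i, if_pos rfl, Finset.piecewise_insert]
    simpa using key Finset.univ
  · obtain ⟨i, hi⟩ := Function.ne_iff.mp h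
    rw [ht i, if_neg hi]

theorem trace_map_eq_mul_trace {Sys : Type} [DecidableEq Sys] {dim : Sys → ℕ} {X Y : Finset Sys}
    (M : SuperOp dim X Y) (z : ∀ s, Fin (dim s))
    (hns : ∀ s ∈ X, ∃ B ⊆ Y, ¬ Signals M {s} B) (ρ : Op dim X) :
    (M ρ).trace = (M (Matrix.single (baseLabel z X) (baseLabel z X) 1)).trace * ρ.trace := by
  have hsingle : ∀ x y : Config dim X, (M (Matrix.single x y 1)).trace =
      if x = y then (M (Matrix.single (baseLabel z X) (baseLabel z X) 1)).trace else 0 := by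
    refine eq_diagonal_of_eq_update (baseLabel z X)
      (fun x y => (M (Matrix.single x y 1)).trace) fun s x y => ?_
    obtain ⟨B, hB, hs⟩ := hns s.1 s.2
    have hA : {s.1} ⊆ X := Finset.singleton_subset_iff.mpr s.2
    have hglue : ∀ c : Config dim X, glue (A := {s.1}) (baseLabel z _)
        (restrict Finset.sdiff_subset c) = Function.update c s (z s.1) := by
      intro c
      funext r
      by_cases hr : r = s
      · subst hr
        rw [Function.update_self, glue_of_mem _ _ _ (Finset.mem_singleton_self _)]
      · rw [Function.update_of_ne hr, glue_of_not_mem _ _ _ fun hm =>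
          hr (Subtype.ext (Finset.mem_singleton.mp hm))]
        rfl
    have hiff : restrict hA x = restrict hA y ↔ x s = y s :=
      (singleton_eval_bijective dim s.1).injective.eq_iff.symm
    change (M (Matrix.single x y 1)).trace = _
    rw [← trace_reduce hB, ← reduce_eq_of_not_signals hs hB hA (isCPTP_reset (baseLabel z _)),
      trace_reduce hB, applyOn_reset_single, hglue, hglue]
    split_ifs with h₁ h₂ h₂
    · rfl
    · exact absurd (hiff.mp h₁) h₂
    · exact absurd (hiff.mpr h₂) h₁
    · rw [map_zero, Matrix.trace_zero]
  have hexp : (M ρ).trace = ∑ i, ∑ a, ∑ b, ρ a b * M (Matrix.single a b 1) i i :=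
    Finset.sum_congr rfl fun i _ => map_apply_eq_sum M ρ i i
  rw [hexp, Finset.sum_comm, Matrix.trace, Matrix.trace, Finset.mul_sum]
  refine Finset.sum_congr rfl fun x _ => ?_
  rw [Finset.sum_comm, Finset.sum_eq_single x]
  · rw [← Finset.mul_sum, mul_comm]
    congr 1
    exact (hsingle x x).trans (if_pos rfl)
  · intro y _ hy
    rw [← Finset.mul_sum]
    exact mul_eq_zero_of_right _ ((hsingle x y).trans (if_neg hy.symm))
  · simp

/-! ### Fixed order and normalisation -/

theorem sum_prob_eq_prob_sum {P : Type} [Fintype P] [DecidableEq P] {dI dO : P → ℕ} {κ : P → Type}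
    (W : ProcessOp dI dO) (f : ∀ p, κ p → LocalOp (dI p) (dO p)) (S : ∀ p, Finset (κ p)) :
    ∑ z ∈ Fintype.piFinset S, prob W (fun p => f p (z p)) =
      prob W (fun p => ∑ t ∈ S p, f p t) := by
  have h : ∀ p u v, choi (∑ t ∈ S p, f p t) u v = ∑ t ∈ S p, choi (f p t) u v := fun p u v => by
    simp only [choi, Matrix.of_apply, LinearMap.sum_apply, Matrix.sum_apply]
  simp only [prob_eq_sum, h, Finset.prod_univ_sum, Finset.sum_mul]
  rw [Finset.sum_comm]
  exact Finset.sum_congr rfl fun v _ => Finset.sum_comm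

open Classical in
theorem isFixedOrder_processOfMap {Sys P : Type} [DecidableEq Sys] [Fintype P] [DecidableEq P]
    {dim : Sys → ℕ} {X Y : Finset Sys} (ord : PartialOrder P) (eI : P ≃ {s // s ∈ Y})
    (eO : P ≃ {s // s ∈ X}) (M : SuperOp dim X Y) (z : ∀ s, Fin (dim s))
    (hns : ∀ (p : P) (U : Finset P), p ∉ U → (∀ q, ord.lt p q → q ∈ U) →
      ¬ Signals M {(eO p).1} (inputsOff eI U)) :
    IsFixedOrder (processOfMap eI eO M) := by
  refine ⟨ord, fun nS nX J p a a' haa x => ?_⟩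
  let S : ∀ q, Finset (Fin (nX q)) := fun q => if ord.le p q then Finset.univ else {x q}
  let U : Finset P := Finset.univ.filter fun q => ord.le p q
  have hmem : ∀ q, q ∈ U ↔ ord.le p q := fun q => by simp [U]
  have hS : (Finset.univ.filter fun z : (∀ q, Fin (nX q)) => ∀ q, ¬ ord.le p q → z q = x q) =
      Fintype.piFinset S := by
    ext y
    simp only [Finset.mem_filter, Finset.mem_univ, true_and, Fintype.mem_piFinset, S]
    refine forall_congr' fun q => ?_
    split_ifs with h <;> simp [h]
  have key : ∀ b : ∀ q, Fin (nS q),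
      (∑ y : (∀ q, Fin (nX q)) with ∀ q, ¬ ord.le p q → y q = x q,
        prob (processOfMap eI eO M) (fun q => (J q).op (b q) (y q))) =
      prob (processOfMap eI eO M) (fun q => if q ∈ U then reset (z (eO q).1) else
        ∑ t ∈ S q, (J q).op (b q) t) := by
    intro b
    rw [hS, sum_prob_eq_prob_sum (processOfMap eI eO M) (fun q => (J q).op (b q)) S]
    refine (prob_reset_upper eI eO M z hns _ U (fun q hq r hr => ?_) fun q hq ρ => ?_).symm
    · exact (hmem r).mpr (ord.le_trans _ _ _ ((hmem q).mp hq) hr)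
    · simp only [S, if_pos ((hmem q).mp hq)]
      exact ((J q).cptp (b q)).2 ρ
  rw [key, key]
  congr 1
  funext q
  by_cases hq : q ∈ U
  · rw [if_pos hq, if_pos hq]
  · rw [if_neg hq, if_neg hq, haa q fun h => hq ((hmem q).mpr (h ▸ ord.le_refl p))]

theorem prob_processOfMap_eq_trace {Sys P : Type} [DecidableEq Sys] [Fintype P] [DecidableEq P]
    {dim : Sys → ℕ} {X Y : Finset Sys} (ord : PartialOrder P) (eI : P ≃ {s // s ∈ Y})
    (eO : P ≃ {s // s ∈ X}) (M : SuperOp dim X Y) (z : ∀ s, Fin (dim s))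
    (hns : ∀ (p : P) (U : Finset P), p ∉ U → (∀ q, ord.lt p q → q ∈ U) →
      ¬ Signals M {(eO p).1} (inputsOff eI U))
    (L : ∀ p, LocalOp (dim (eI p).1) (dim (eO p).1)) (hL : ∀ p ρ, (L p ρ).trace = ρ.trace) :
    prob (processOfMap eI eO M) L =
      (M (Matrix.single (baseLabel z X) (baseLabel z X) 1)).trace := by
  rw [← prob_reset eI eO M z, ← prob_reset_upper eI eO M z hns L Finset.univ
    (fun _ _ q _ => Finset.mem_univ q) fun p _ => hL p]
  simp only [Finset.mem_univ, if_true]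

theorem trace_single_eq_one {Sys P α γ : Type} [DecidableEq Sys] [Fintype P] [DecidableEq P]
    [Fintype α] [Fintype γ] {dim : Sys → ℕ} {X Y : Finset Sys} (ord : PartialOrder P)
    (eI : P ≃ {s // s ∈ Y}) (eO : P ≃ {s // s ∈ X}) (M : SuperOp dim X Y)
    (z : ∀ s, Fin (dim s))
    (hns : ∀ (p : P) (U : Finset P), p ∉ U → (∀ q, ord.lt p q → q ∈ U) →
      ¬ Signals M {(eO p).1} (inputsOff eI U))
    {Enc : Matrix α α ℂ →ₗ[ℂ] Op dim X} {Dec : Op dim Y →ₗ[ℂ] Matrix γ γ ℂ}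
    (hEnc : IsCPTP Enc) (hDec : IsCPTPOnImage Dec (M ∘ₗ Enc)) {ρ : Matrix α α ℂ}
    (hρ : ρ.trace = 1) (h : ((Dec ∘ₗ M ∘ₗ Enc) ρ).trace = 1) :
    (M (Matrix.single (baseLabel z X) (baseLabel z X) 1)).trace = 1 := by
  have hM := trace_map_eq_mul_trace M z (fun s hs => ?_) (Enc ρ)
  · rw [hEnc.2, hρ, mul_one] at hM
    rw [← hM, ← h]
    exact (hDec.2 ρ).symm
  · obtain ⟨p, hp⟩ := eO.surjective ⟨s, hs⟩
    refine ⟨_, inputsOff_subset eI (Finset.univ.erase p), ?_⟩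
    have hps : (eO p).1 = s := congrArg Subtype.val hp
    rw [← hps]
    refine hns p _ (Finset.notMem_erase p _) fun q hq => ?_
    exact Finset.mem_erase.mpr ⟨hq.ne', Finset.mem_univ q⟩

/-! ### Process maps and process matrices -/

theorem map_submatrix_eq_processMap {Sys P : Type} [DecidableEq Sys] [Fintype P] [DecidableEq P]
    {dim : Sys → ℕ} {X Y : Finset Sys} (eI : P ≃ {s // s ∈ Y}) (eO : P ≃ {s // s ∈ X})
    (M : SuperOp dim X Y)
    (ρ : Matrix (PartyConfig fun p => dim (eO p).1) (PartyConfig fun p => dim (eO p).1) ℂ) :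
    M (ρ.submatrix (labelEquiv dim eO).symm (labelEquiv dim eO).symm) =
      (processMap (processOfMap eI eO M) ρ).submatrix (labelEquiv dim eI).symm
        (labelEquiv dim eI).symm := by
  ext x y
  rw [map_apply_eq_sum, ← (labelEquiv dim eO).sum_comp]
  simp only [processMap, processOfMap, Matrix.submatrix_apply, Matrix.of_apply,
    Equiv.apply_symm_apply, Equiv.symm_apply_apply]
  refine Finset.sum_congr rfl fun a _ => ?_
  rw [← (labelEquiv dim eO).sum_comp]
  simp only [Equiv.symm_apply_apply]

theorem posSemidef_processOfMap {Sys P : Type} [DecidableEq Sys] {dim : Sys → ℕ}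
    {X Y : Finset Sys} (eI : P ≃ {s // s ∈ Y}) (eO : P ≃ {s // s ∈ X}) (M : SuperOp dim X Y)
    (hM : (Matrix.of fun u v : Config dim X × Config dim Y =>
      M (Matrix.single u.1 v.1 1) u.2 v.2).PosSemidef) :
    (processOfMap eI eO M).PosSemidef := by
  have h := hM.submatrix
    fun u : PartyConfig (fun p => dim (eI p).1) × PartyConfig (fun p => dim (eO p).1) =>
      (labelEquiv dim eO u.2, labelEquiv dim eI u.1)
  exact h

theorem processMap_single {P : Type} [Fintype P] [DecidableEq P] {dI dO : P → ℕ}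
    (W : ProcessOp dI dO) (o o' : PartyConfig dO) (x y : PartyConfig dI) :
    processMap W (Matrix.single o o' 1) x y = W (x, o) (y, o') := by
  rw [processMap, Matrix.of_apply, Finset.sum_eq_single o, Finset.sum_eq_single o']
  · simp
  · intro b _ hb
    simp [hb.symm]
  · simp
  · intro a _ ha
    simp [ha.symm]
  · simp

theorem eq_processOfMap {Sys P : Type} [DecidableEq Sys] [Fintype P] [DecidableEq P]
    {dim : Sys → ℕ} {X Y : Finset Sys} (eI : P ≃ {s // s ∈ Y}) (eO : P ≃ {s // s ∈ X})
    (M : SuperOp dim X Y) (W : ProcessOp (fun p => dim (eI p).1) (fun p => dim (eO p).1))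
    (h : ∀ ρ, M (ρ.submatrix (labelEquiv dim eO).symm (labelEquiv dim eO).symm) =
      (processMap W ρ).submatrix (labelEquiv dim eI).symm (labelEquiv dim eI).symm) :
    W = processOfMap eI eO M := by
  ext u v
  rw [← processMap_single W u.2 v.2 u.1 v.1, ← processMap_single (processOfMap eI eO M)]
  have h' := (h (Matrix.single u.2 v.2 1)).symm.trans (map_submatrix_eq_processMap eI eO M _)
  simpa using congrFun (congrFun h' (labelEquiv dim eI u.1)) (labelEquiv dim eI v.1)

/-- Communicating process networks from a full sub-network and an enumeration of its free in- and
outputs. -/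
theorem isCommunicatingProcessNetwork_processOfMap {𝔑 : QNetwork} {P : Type} [Fintype P]
    [DecidableEq P] (env : SubNetwork 𝔑) (eI : P ≃ {s // s ∈ env.freeOut})
    (eO : P ≃ {s // s ∈ env.freeIn})
    (hfull : ∀ s, (∃ m ∈ env.maps, 𝔑.src s = some m) → (∃ m ∈ env.maps, 𝔑.tgt s = some m) →
      s ∈ env.comps)
    (hI : ∀ s ∈ env.freeOut, ∃ m, m ∉ env.maps ∧ 𝔑.tgt s = some m)
    (hO : ∀ s ∈ env.freeIn, ∃ m, m ∉ env.maps ∧ 𝔑.src s = some m) :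
    IsCommunicatingProcessNetwork 𝔑 (fun p => (eI p).1) (fun p => (eO p).1) env
      (processOfMap eI eO env.induced) where
  I_injective := Subtype.val_injective.comp eI.injective
  O_injective := Subtype.val_injective.comp eO.injective
  full := hfull
  I_mem p := (eI p).2
  O_mem p := (eO p).2
  freeOut_eq s hs := ⟨eI.symm ⟨s, hs⟩, by rw [Equiv.apply_symm_apply]⟩
  freeIn_eq s hs := ⟨eO.symm ⟨s, hs⟩, by rw [Equiv.apply_symm_apply]⟩
  I_received p := hI _ (eI p).2
  O_sent p := hO _ (eO p).2
  induced_eq ρ := map_submatrix_eq_processMap eI eO env.induced ρ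

/-- In a process network the process map preserves the trace of basis states. -/
theorem IsCommunicatingProcessNetwork.trace_induced_single {𝔑 : QNetwork} {P : Type} [Fintype P]
    [DecidableEq P] {I O : P → 𝔑.Sys} {env : SubNetwork 𝔑}
    {W : ProcessOp (fun p => 𝔑.dim (I p)) (fun p => 𝔑.dim (O p))}
    (h : IsCommunicatingProcessNetwork 𝔑 I O env W) (hW : IsProcessMatrix W)
    (z : ∀ s, Fin (𝔑.dim s)) :
    (env.induced (Matrix.single (baseLabel z _) (baseLabel z _) 1)).trace = 1 := by
  let eI : P ≃ {s // s ∈ env.freeOut} := Equiv.ofBijective (fun p => ⟨I p, h.I_mem p⟩)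
    ⟨fun p q hpq => h.I_injective (congrArg Subtype.val hpq),
      fun s => (h.freeOut_eq s.1 s.2).imp fun p hp => Subtype.ext hp.symm⟩
  let eO : P ≃ {s // s ∈ env.freeIn} := Equiv.ofBijective (fun p => ⟨O p, h.O_mem p⟩)
    ⟨fun p q hpq => h.O_injective (congrArg Subtype.val hpq),
      fun s => (h.freeIn_eq s.1 s.2).imp fun p hp => Subtype.ext hp.symm⟩
  have hWM : W = processOfMap eI eO env.induced :=
    eq_processOfMap eI eO env.induced W h.induced_eq
  rw [← prob_reset eI eO env.induced z, ← hWM]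
  exact hW.2 _ fun p => isCPTP_reset _

/-! ### Fine-grained systems -/

/-- The members of the sets `F (J i)`, for disjoint `F` and injective `J`, enumerate their union. -/
def sigmaEquivUnion {ι Sys Sys' : Type} {F : Sys → Finset Sys'}
    (hF : ∀ s t, s ≠ t → Disjoint (F s) (F t)) {J : ι → Sys} (hJ : Function.Injective J)
    {Y : Finset Sys'} (hY : ∀ t, t ∈ Y ↔ ∃ i, t ∈ F (J i)) :
    (Σ i, {t // t ∈ F (J i)}) ≃ {t // t ∈ Y} :=
  Equiv.ofBijective (fun k => ⟨k.2.1, (hY _).mpr ⟨k.1, k.2.2⟩⟩) <| by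
    constructor
    · rintro ⟨i, t, ht⟩ ⟨j, t', ht'⟩ h
      obtain rfl : t = t' := congrArg Subtype.val h
      obtain rfl : i = j := by
        by_contra hij
        exact Finset.disjoint_left.mp (hF _ _ (hJ.ne hij)) ht ht'
      rfl
    · rintro ⟨t, ht⟩
      obtain ⟨i, hi⟩ := (hY t).mp ht
      exact ⟨⟨i, t, hi⟩, rfl⟩

theorem mem_iff_exists_label {ι κ Sys : Type} {G : ι → Finset Sys} (e : κ ≃ Σ i, {t // t ∈ G i})
    (i : ι) (t : Sys) : t ∈ G i ↔ ∃ p, (e p).1 = i ∧ t = (e p).2.1 := by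
  constructor
  · intro ht
    exact ⟨e.symm ⟨i, t, ht⟩, by rw [Equiv.apply_symm_apply], by rw [Equiv.apply_symm_apply]⟩
  · rintro ⟨p, rfl, rfl⟩
    exact (e p).2.2

namespace SubNetwork

theorem mem_freeIn {𝔑 : QNetwork} (σ : SubNetwork 𝔑) (s : 𝔑.Sys) :
    s ∈ σ.freeIn ↔ (∃ m ∈ σ.maps, 𝔑.tgt s = some m) ∧ s ∉ σ.comps := by
  simp [freeIn, inputs]

theorem mem_freeOut {𝔑 : QNetwork} (σ : SubNetwork 𝔑) (s : 𝔑.Sys) :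
    s ∈ σ.freeOut ↔ (∃ m ∈ σ.maps, 𝔑.src s = some m) ∧ s ∉ σ.comps := by
  simp [freeOut, outputs]

/-- The sub-network of a single map. -/
def ofMap {𝔑 : QNetwork} (m : 𝔑.Map) : SubNetwork 𝔑 where
  maps := {m}
  comps := ∅
  src_mem s hs := absurd hs (Finset.notMem_empty s)
  tgt_mem s hs := absurd hs (Finset.notMem_empty s)

end SubNetwork

namespace IsNetworkFineGraining

theorem exists_tgt {𝔑 𝔑' : QNetwork} {F : 𝔑.Sys → Finset 𝔑'.Sys}
    (h : IsNetworkFineGraining 𝔑 𝔑' F) {s : 𝔑.Sys} {m : 𝔑.Map} (hs : 𝔑.tgt s = some m)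
    {t : 𝔑'.Sys} (ht : t ∈ F s) : ∃ m', 𝔑'.tgt t = some m' := by
  obtain ⟨σ, hσ⟩ := h.sub (SubNetwork.ofMap m)
  have hmem : t ∈ σ.freeIn := hσ.inputs_eq ▸ Finset.mem_biUnion.mpr
    ⟨s, (SubNetwork.mem_freeIn _ s).mpr
      ⟨⟨m, Finset.mem_singleton_self m, hs⟩, Finset.notMem_empty s⟩, ht⟩
  exact ((σ.mem_freeIn t).mp hmem).1.imp fun _ => And.right

theorem exists_src {𝔑 𝔑' : QNetwork} {F : 𝔑.Sys → Finset 𝔑'.Sys}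
    (h : IsNetworkFineGraining 𝔑 𝔑' F) {s : 𝔑.Sys} {m : 𝔑.Map} (hs : 𝔑.src s = some m)
    {t : 𝔑'.Sys} (ht : t ∈ F s) : ∃ m', 𝔑'.src t = some m' := by
  obtain ⟨σ, hσ⟩ := h.sub (SubNetwork.ofMap m)
  have hmem : t ∈ σ.freeOut := hσ.outputs_eq ▸ Finset.mem_biUnion.mpr
    ⟨s, (SubNetwork.mem_freeOut _ s).mpr
      ⟨⟨m, Finset.mem_singleton_self m, hs⟩, Finset.notMem_empty s⟩, ht⟩
  exact ((σ.mem_freeOut t).mp hmem).1.imp fun _ => And.right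

end IsNetworkFineGraining

/-- The causal order of parties with inputs `If p`, outputs `Of p` in an acyclic region causal
structure: `p` precedes `q` if there is a path from the output of `p` to the input of `q`. -/
@[reducible] def partyOrder {T : Type*} [PartialOrder T] {Sys P : Type} (E : Sys → Set T)
    (If Of : P → Sys)
    (hacyc : ∀ R, ¬ RegionPath E R R) (hprec : ∀ p, RegionPrec (E (If p)) (E (Of p))) :
    PartialOrder P where
  le p q := p = q ∨ RegionPath E (E (Of p)) (E (If q))
  le_refl p := Or.inl rfl
  le_trans p q r hpq hqr := by
    obtain rfl | hpq := hpq
    · exact hqr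
    obtain rfl | hqr := hqr
    · exact Or.inr hpq
    exact Or.inr ((hpq.tail ⟨⟨_, rfl⟩, ⟨_, rfl⟩, hprec q⟩).trans hqr)
  le_antisymm p q hpq hqp := by
    obtain rfl | hpq := hpq
    · rfl
    obtain rfl | hqp := hqp
    · rfl
    exact absurd (((hpq.tail ⟨⟨_, rfl⟩, ⟨_, rfl⟩, hprec q⟩).trans hqp).tail
      ⟨⟨_, rfl⟩, ⟨_, rfl⟩, hprec p⟩) (hacyc _)

theorem partyOrder_lt {T : Type*} [PartialOrder T] {Sys P : Type} {E : Sys → Set T}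
    {If Of : P → Sys} (hacyc : ∀ R, ¬ RegionPath E R R)
    (hprec : ∀ p, RegionPrec (E (If p)) (E (Of p))) {p q : P}
    (h : RegionPath E (E (Of p)) (E (If q))) : (partyOrder E If Of hacyc hprec).lt p q := by
  refine @lt_of_le_of_ne _ (partyOrder E If Of hacyc hprec) _ _ (Or.inr h) ?_
  rintro rfl
  exact hacyc _ (h.tail ⟨⟨_, rfl⟩, ⟨_, rfl⟩, hprec p⟩)

end QCausal

end

theorem theorem2 {T : Type*} [PartialOrder T] (N : ℕ) (𝔑 : QCausal.QNetwork)
    (I O : Fin N → 𝔑.Sys) (env : QCausal.SubNetwork 𝔑) (lab : Fin N → 𝔑.Map)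
    (W : QCausal.ProcessOp (fun p => 𝔑.dim (I p)) (fun p => 𝔑.dim (O p)))
    (hW : QCausal.IsProcessMatrix W)
    (h𝔑 : QCausal.IsProcessNetwork 𝔑 I O env lab W)
    (R : QCausal.SpacetimeRealisation T 𝔑)
    (hio : R.InputOutputCorrespondence I O)
    (hrc : R.RelativisticCausality) :
    ∃ (M : ℕ) (If Of : Fin M → R.fine.Sys) (envf : QCausal.SubNetwork R.fine)
      (Wf : QCausal.ProcessOp (fun p => R.fine.dim (If p)) (fun p => R.fine.dim (Of p)))
      (owner : Fin M → Fin N),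
      N ≤ M ∧
      QCausal.IsProcessMatrix Wf ∧
      QCausal.IsFixedOrder Wf ∧
      QCausal.IsCommunicatingProcessNetwork R.fine If Of envf Wf ∧
      QCausal.IsFineGraining R.F env.induced envf.induced ∧
      (∀ i t, t ∈ R.F (I i) ↔ ∃ p, owner p = i ∧ t = If p) ∧
      (∀ i t, t ∈ R.F (O i) ↔ ∃ p, owner p = i ∧ t = Of p) := by
  open QCausal in
  obtain ⟨envf, hf⟩ := R.isFineGraining.sub env
  have hdisj := R.isFineGraining.disjoint
  have hsys : ∀ p q, I p ≠ O q := by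
    intro p q hpq
    obtain ⟨m, hm, hsrc⟩ := ((env.mem_freeOut _).mp (h𝔑.I_mem p)).1
    rw [hpq, h𝔑.src_O q] at hsrc
    exact h𝔑.lab_not_mem q (Option.some.inj hsrc ▸ hm)
  have hY : ∀ t, t ∈ envf.freeOut ↔ ∃ i, t ∈ R.F (I i) := by
    intro t
    rw [hf.outputs_eq, Finset.mem_biUnion]
    constructor
    · rintro ⟨s, hs, ht⟩
      obtain ⟨p, rfl⟩ := h𝔑.freeOut_eq s hs
      exact ⟨p, ht⟩
    · exact fun ⟨i, hi⟩ => ⟨I i, h𝔑.I_mem i, hi⟩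
  have hX : ∀ t, t ∈ envf.freeIn ↔ ∃ i, t ∈ R.F (O i) := by
    intro t
    rw [hf.inputs_eq, Finset.mem_biUnion]
    constructor
    · rintro ⟨s, hs, ht⟩
      obtain ⟨p, rfl⟩ := h𝔑.freeIn_eq s hs
      exact ⟨p, ht⟩
    · exact fun ⟨i, hi⟩ => ⟨O i, h𝔑.O_mem i, hi⟩
  have hXY : ∀ t, t ∈ envf.freeIn → t ∉ envf.freeOut := by
    intro t hin hout
    obtain ⟨i, hi⟩ := (hX t).mp hin
    obtain ⟨j, hj⟩ := (hY t).mp hout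
    exact Finset.disjoint_left.mp (hdisj _ _ (hsys j i)) hj hi
  have hfull : ∀ s, (∃ m ∈ envf.maps, R.fine.src s = some m) →
      (∃ m ∈ envf.maps, R.fine.tgt s = some m) → s ∈ envf.comps := by
    intro s hsrc htgt
    by_contra hs
    exact hXY s ((envf.mem_freeIn s).mpr ⟨htgt, hs⟩) ((envf.mem_freeOut s).mpr ⟨hsrc, hs⟩)
  choose β hβ using hio
  obtain ⟨M, ⟨e⟩⟩ := Finite.exists_equiv_fin (Σ i, {t // t ∈ R.F (I i)})
  let eI := e.symm.trans (sigmaEquivUnion hdisj h𝔑.I_injective hY)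
  let eO := e.symm.trans ((Equiv.sigmaCongrRight β).trans (sigmaEquivUnion hdisj h𝔑.O_injective hX))
  have hprec : ∀ p, RegionPrec (R.fineEmbed (eI p).1) (R.fineEmbed (eO p).1) :=
    fun p => hβ (e.symm p).1 (e.symm p).2
  let ord := partyOrder R.fineEmbed (fun p => (eI p).1) (fun p => (eO p).1) R.acyclic hprec
  have hns : ∀ p U, p ∉ U → (∀ q, ord.lt p q → q ∈ U) →
      ¬ Signals envf.induced {(eO p).1} (inputsOff eI U) := by
    intro p U hp hU hsig
    have hdis : Disjoint {(eO p).1} (inputsOff eI U) := Finset.disjoint_singleton_left.mpr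
      fun hmem => hXY _ (eO p).2 (inputsOff_subset eI U hmem)
    obtain ⟨s, hs, t, ht, hpath⟩ := hrc _ _ hdis ⟨_, (mem_inputsOff eI U p).mpr hp⟩
      ⟨envf, hsig⟩
    obtain rfl := Finset.mem_singleton.mp hs
    obtain ⟨q, hq, rfl⟩ := Finset.mem_image.mp ht
    exact Finset.mem_compl.mp hq (hU q (partyOrder_lt R.acyclic hprec hpath))
  let z : ∀ s, Fin (𝔑.dim s) := fun s => ⟨0, 𝔑.dim_pos s⟩
  let zf : ∀ s, Fin (R.fine.dim s) := fun s => ⟨0, R.fine.dim_pos s⟩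
  obtain ⟨Enc, Dec, hEnc, hDec, hED⟩ := hf.enc_dec
  have htrace := trace_single_eq_one ord eI eO envf.induced zf hns hEnc hDec
    (Matrix.trace_single_eq_same (baseLabel z _) 1)
    (hED ▸ h𝔑.toIsCommunicatingProcessNetwork.trace_induced_single hW z)
  refine ⟨M, fun p => (eI p).1, fun p => (eO p).1, envf, processOfMap eI eO envf.induced,
    fun p => (e.symm p).1, ?_, ⟨?_, fun L hL => ?_⟩, isFixedOrder_processOfMap ord eI eO _ zf hns,
    isCommunicatingProcessNetwork_processOfMap envf eI eO hfull ?_ ?_, hf, ?_, ?_⟩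
  · simpa using Fintype.card_le_of_injective (fun i => e (⟨i, _,
      (R.isFineGraining.nonempty (I i)).choose_spec⟩ : Σ i, {t // t ∈ R.F (I i)}))
      fun i j hij => congrArg Sigma.fst (e.injective hij)
  · exact posSemidef_processOfMap eI eO envf.induced envf.posSemidef_choi_induced
  · rw [prob_processOfMap_eq_trace ord eI eO _ zf hns L fun p => (hL p).2, htrace]
  · intro t ht
    obtain ⟨i, hi⟩ := (hY t).mp ht
    obtain ⟨m, hm⟩ := R.isFineGraining.exists_tgt (h𝔑.tgt_I i) hi
    obtain ⟨hsrc, hcomp⟩ := (envf.mem_freeOut t).mp ht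
    exact ⟨m, fun hmem => hcomp (hfull t hsrc ⟨m, hmem, hm⟩), hm⟩
  · intro t ht
    obtain ⟨i, hi⟩ := (hX t).mp ht
    obtain ⟨m, hm⟩ := R.isFineGraining.exists_src (h𝔑.src_O i) hi
    obtain ⟨htgt, hcomp⟩ := (envf.mem_freeIn t).mp ht
    exact ⟨m, fun hmem => hcomp (hfull t ⟨m, hmem, hm⟩ htgt), hm⟩
  · exact mem_iff_exists_label e.symm
  · exact mem_iff_exists_label (e.symm.trans (Equiv.sigmaCongrRight β))
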